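/- Let $\mathbf u=u_0u_1u_2\cdots$ be a standard Sturmian word over $\{0,1\}$, i.e. $\mathbf u$ has exactly $n+1$ distinct factors of length $n$ for every $n\in\mathbb N=\{0,1,2,\dots\}$, and each prefix $w$ of $\mathbf u$ is left special (both $0w$ and $1w$ are factors of $\mathbf u$). Let $$inr\mathcal C_{\mathbf u}(n)=\max\{m\in\mathbb N:\ u_i\cdots u_{i+n-1}\neq u_j\cdots u_{j+n-1}\ \text{ for all } 0\le i<j\le m-1\}.$$ Then $inr\mathcal C_{\mathbf u}(n)=n+1$ for infinitely many $n\in\mathbb N$. Specifically, for $i\in\{0,1\}$ let $\varphi_i$ be the morphism with $\varphi_i(i)=i$ and $\varphi_i(j)=ij$ for $j\neq i$. The word $\mathbf u$ has a directive sequence, i.e. a sequence $(i_k)_{k\ge 0}$ in $\{0,1\}$ for which there are standard Sturmian words $\mathbf u^{(0)}=\mathbf u,\mathbf u^{(1)},\mathbf u^{(2)},\dots$ with $\mathbf u^{(k)}=\varphi_{i_k}(\mathbf u^{(k+1)})$ for all $k\in\mathbb N$. Let $B(k)$ denote the $k$-th bispecial factor of $\mathbf u$ (a word $w$ such that $0w$,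 $1w$, $w0$ and $w1$ are all factors of $\mathbf u$), where bispecial factors are ordered by length and counted from $B(0)=\varepsilon$, the empty word. Then for every directive sequence $(i_k)_{k\ge 0}$ of $\mathbf u$ and every $k\in\mathbb N$ with $i_k\neq i_{k+1}$, the equality $inr\mathcal C_{\mathbf u}(n)=n+1$ holds for $n=|B(k)|+1$. -/

import Mathlib

/-! Infinite words over an alphabet `α` are functions `ℕ → α`, finite words are lists. -/

namespace InfWord

variable {α : Type*}

/-- The factor `u_i u_{i+1} ⋯ u_{i+n-1}` of length `n` of `u` at position `i`. -/
def factorAt (u : ℕ → α) (n i : ℕ) : List α := (List.range n).map fun j => u (i + j)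

/-- The language of `u`: the set of its factors. -/
def language (u : ℕ → α) : Set (List α) := {w | ∃ i, factorAt u w.length i = w}

/-- The factor complexity: the number of distinct factors of length `n`. -/
noncomputable def complexity (u : ℕ → α) (n : ℕ) : ℕ := {w ∈ language u | w.length = n}.ncard

/-- The first `m` factors of length `n` (at the positions `0, …, m - 1`) are pairwise distinct. -/
def InitialNonrepetitive (u : ℕ → α) (n m : ℕ) : Prop :=
  ∀ i j, i < j → j < m → factorAt u n i ≠ factorAt u n j

/-- The initial non-repetitive complexity: the maximal `m` such that the first `m` factors of
length `n` are pairwise distinct (a maximum over a finite alphabet, see `isGreatest_inrC`). -/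
noncomputable def inrC (u : ℕ → α) (n : ℕ) : ℕ := sSup {m | InitialNonrepetitive u n m}

theorem isGreatest_inrC [Finite α] (u : ℕ → α) (n : ℕ) :
    IsGreatest {m | InitialNonrepetitive u n m} (inrC u n) := by
  have hne : {m | InitialNonrepetitive u n m}.Nonempty :=
    ⟨0, fun i j _ hj => absurd hj (Nat.not_lt_zero j)⟩
  have hfin : (Set.range (factorAt u n)).Finite := by
    refine (List.finite_length_eq α n).subset ?_
    rintro _ ⟨i, rfl⟩
    simp [factorAt]
  have hbdd : BddAbove {m | InitialNonrepetitive u n m} := by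
    refine ⟨(Set.range (factorAt u n)).ncard, fun m hm => ?_⟩
    have hinj : Set.InjOn (factorAt u n) (Set.Iio m) := by
      intro i hi j hj hij
      by_contra hne
      rcases Nat.lt_or_gt_of_ne hne with h | h
      · exact hm i j h hj hij
      · exact hm j i h hi hij.symm
    calc m = (Set.Iio m).ncard := by simp [Set.ncard_eq_toFinset_card']
      _ = (factorAt u n '' Set.Iio m).ncard := (Set.ncard_image_of_injOn hinj).symm
      _ ≤ _ := Set.ncard_le_ncard (Set.image_subset_range _ _) hfin
  exact ⟨Nat.sSup_mem hne hbdd, fun m hm => le_csSup hbdd hm⟩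

/-- `w` is left special: `aw` and `bw` are factors of `u` for two distinct letters `a`, `b`. -/
def IsLeftSpecial (u : ℕ → α) (w : List α) : Prop :=
  ∃ a b, a ≠ b ∧ a :: w ∈ language u ∧ b :: w ∈ language u

/-- `w` is right special: `wa` and `wb` are factors of `u` for two distinct letters `a`, `b`. -/
def IsRightSpecial (u : ℕ → α) (w : List α) : Prop :=
  ∃ a b, a ≠ b ∧ w ++ [a] ∈ language u ∧ w ++ [b] ∈ language u

/-- `w` is bispecial: both left and right special. -/
def IsBispecial (u : ℕ → α) (w : List α) : Prop := IsLeftSpecial u w ∧ IsRightSpecial u w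

/-- `B u k` is the `k`-th bispecial factor of `u`, counted from `0` in the order of length: a
bispecial factor whose length is the `k`-th smallest length of a bispecial factor. -/
noncomputable def B (u : ℕ → α) (k : ℕ) : List α :=
  Classical.epsilon fun w =>
    IsBispecial u w ∧ w.length = Nat.nth (fun l => ∃ v, IsBispecial u v ∧ v.length = l) k

/-- `v = ψ(u)`, for the morphism given by the (non-empty) images `ψ a` of the letters: the words
`ψ(u_0) ψ(u_1) ⋯ ψ(u_{n-1})` are prefixes of `v`. -/
def IsMorphicImage (ψ : α → List α) (u v : ℕ → α) : Prop :=
  ∀ n, factorAt v ((factorAt u n 0).flatMap ψ).length 0 = (factorAt u n 0).flatMap ψ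

/-- The elementary morphism `φ_i : i ↦ i, j ↦ ij` for `j ≠ i`. -/
def elementary [DecidableEq α] (i : α) (j : α) : List α := if j = i then [i] else [i, j]

/-- Sturmian words over the alphabet `{0, 1}`. -/
def IsSturmian (u : ℕ → Fin 2) : Prop := ∀ n, complexity u n = n + 1

/-- A Sturmian word is standard if each of its prefixes is left special. -/
def IsStandardSturmian (u : ℕ → Fin 2) : Prop :=
  IsSturmian u ∧ ∀ n, IsLeftSpecial u (factorAt u n 0)

/-- `i` is the directive sequence of `u`: there are standard Sturmian words `U 0 = u`, `U 1`, …
with `U n = φ_{i n} (U (n + 1))` for all `n`. -/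
def IsDirectiveSequence (u : ℕ → Fin 2) (i : ℕ → Fin 2) : Prop :=
  ∃ U : ℕ → ℕ → Fin 2, U 0 = u ∧ ∀ n,
    IsStandardSturmian (U n) ∧ IsMorphicImage (elementary (i n)) (U (n + 1)) (U n)

end InfWord

/-! In a standard Sturmian word the prefixes are the only left special factors. Hence a repeated
factor can be shifted to the left: while the preceding letters agree, both occurrences move back,
and once they differ the factor is left special, so a prefix. Every early repetition thus yields an
early return of the prefix, and `inrC u n = n + 1` follows when the prefix of length `n` recurs at
none of the positions `1, …, n` (`IsStandardSturmian.inrC_eq`); the complexity gives the upper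
bound.

Absence of such returns is transported along the morphisms. The first two letters of the `k`-th word
are `i k` and `i (k + 1)`; if they differ, its prefix of length 1 does not return at position 1.
`HasLateReturn.image` carries this from length `m + 1` in `u` to length `P m + 2` in `φ_i(u)`. The
same map `m ↦ P m + 1` governs bispecial lengths, since the nonempty bispecial factors of `φ_i(u)`
are the words `φ_i(w)i` with `w` bispecial in `u`. Starting from 0 at level `k`, it reaches `|B(k)|`
at level 0. Infinitely many such `k` exist, because an eventually constant directive sequence would
produce a constant word. -/

namespace InfWord

/-- The factors of length `n` at the positions `i` and `j` coincide. -/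
def Agree {α : Type*} (u : ℕ → α) (i j n : ℕ) : Prop := ∀ k < n, u (i + k) = u (j + k)

/-! ### Factors as coincidences between positions -/

section General

variable {α : Type*} {u : ℕ → α} {i j l n : ℕ}

theorem Agree.symm (h : Agree u i j n) : Agree u j i n := fun k hk => (h k hk).symm

theorem Agree.trans (h : Agree u i j n) (h' : Agree u j l n) : Agree u i l n :=
  fun k hk => (h k hk).trans (h' k hk)

theorem Agree.mono {m : ℕ} (h : Agree u i j n) (hm : m ≤ n) : Agree u i j m :=
  fun k hk => h k (hk.trans_le hm)

theorem Agree.succ (h : Agree u i j n) (hn : u (i + n) = u (j + n)) : Agree u i j (n + 1) := by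
  intro k hk
  rcases Nat.lt_succ_iff_lt_or_eq.1 hk with h' | rfl
  exacts [h k h', hn]

theorem Agree.cons (h : Agree u (i + 1) (j + 1) n) (h0 : u i = u j) : Agree u i j (n + 1) := by
  rintro (_ | k) hk
  · simpa using h0
  · have := h k (by omega)
    rwa [add_right_comm, add_right_comm j] at this

@[simp] theorem length_factorAt (u : ℕ → α) (n i : ℕ) : (factorAt u n i).length = n := by
  simp [factorAt]

theorem factorAt_eq_iff : factorAt u n i = factorAt u n j ↔ Agree u i j n := by
  simp [factorAt, Agree, List.map_inj_left]

theorem factorAt_succ (u : ℕ → α) (n i : ℕ) :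
    factorAt u (n + 1) i = factorAt u n i ++ [u (i + n)] := by
  simp [factorAt, List.range_succ]

theorem factorAt_succ' (u : ℕ → α) (n i : ℕ) :
    factorAt u (n + 1) i = u i :: factorAt u n (i + 1) := by
  simp only [factorAt, List.range_succ_eq_map, List.map_cons, List.map_map, add_zero]
  congr 1
  refine List.map_congr_left fun k _ => ?_
  simp only [Function.comp]
  congr 1
  omega

theorem factorAt_mem_language (u : ℕ → α) (n i : ℕ) : factorAt u n i ∈ language u :=
  ⟨i, by simp⟩

theorem cons_factorAt_mem_language_iff {a : α} :
    a :: factorAt u n i ∈ language u ↔ ∃ s, u s = a ∧ Agree u (s + 1) i n := by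
  constructor
  · rintro ⟨s, hs⟩
    rw [List.length_cons, factorAt_succ', length_factorAt] at hs
    injection hs with h1 h2
    exact ⟨s, h1, factorAt_eq_iff.1 h2⟩
  · rintro ⟨s, rfl, h⟩
    rw [← factorAt_eq_iff.2 h, ← factorAt_succ']
    exact factorAt_mem_language _ _ _

theorem factorAt_append_mem_language_iff {a : α} :
    factorAt u n i ++ [a] ∈ language u ↔ ∃ s, u (s + n) = a ∧ Agree u s i n := by
  constructor
  · rintro ⟨s, hs⟩
    rw [List.length_append, length_factorAt, List.length_singleton, factorAt_succ] at hs
    obtain ⟨h1, h2⟩ := List.append_inj hs (by simp)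
    exact ⟨s, by simpa using h2, factorAt_eq_iff.1 h1⟩
  · rintro ⟨s, rfl, h⟩
    rw [← factorAt_eq_iff.2 h, ← factorAt_succ]
    exact factorAt_mem_language _ _ _

theorem isLeftSpecial_factorAt_iff : IsLeftSpecial u (factorAt u n i) ↔
    ∃ s t, u s ≠ u t ∧ Agree u (s + 1) i n ∧ Agree u (t + 1) i n := by
  simp only [IsLeftSpecial, cons_factorAt_mem_language_iff]
  constructor
  · rintro ⟨_, _, hab, ⟨s, rfl, hs⟩, t, rfl, ht⟩
    exact ⟨s, t, hab, hs, ht⟩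
  · rintro ⟨s, t, hab, hs, ht⟩
    exact ⟨_, _, hab, ⟨s, rfl, hs⟩, t, rfl, ht⟩

theorem isRightSpecial_factorAt_iff : IsRightSpecial u (factorAt u n i) ↔
    ∃ s t, u (s + n) ≠ u (t + n) ∧ Agree u s i n ∧ Agree u t i n := by
  simp only [IsRightSpecial, factorAt_append_mem_language_iff]
  constructor
  · rintro ⟨_, _, hab, ⟨s, rfl, hs⟩, t, rfl, ht⟩
    exact ⟨s, t, hab, hs, ht⟩
  · rintro ⟨s, t, hab, hs, ht⟩
    exact ⟨_, _, hab, ⟨s, rfl, hs⟩, t, rfl, ht⟩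

theorem exists_eq_factorAt {w : List α} (hw : w ∈ language u) : ∃ i, w = factorAt u w.length i :=
  hw.imp fun _ h => h.symm

theorem IsLeftSpecial.mem_language {w : List α} (hw : IsLeftSpecial u w) : w ∈ language u := by
  obtain ⟨a, -, -, ha, -⟩ := hw
  obtain ⟨i, hi⟩ := exists_eq_factorAt ha
  rw [List.length_cons, factorAt_succ'] at hi
  injection hi with _ h
  rw [h]
  exact factorAt_mem_language _ _ _

theorem finite_language_length [Finite α] (u : ℕ → α) (n : ℕ) :
    {w ∈ language u | w.length = n}.Finite :=
  (List.finite_length_eq α n).subset fun _ h => h.2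

/-- The first factors that are pairwise distinct are at most as many as all factors. -/
theorem InitialNonrepetitive.le_complexity [Finite α] {m : ℕ} (h : InitialNonrepetitive u n m) :
    m ≤ complexity u n := by
  have hinj : Set.InjOn (factorAt u n) (Set.Iio m) := by
    intro i hi j hj hij
    by_contra hne
    rcases Nat.lt_or_gt_of_ne hne with h' | h'
    · exact h i j h' hj hij
    · exact h j i h' hi hij.symm
  calc m = (Set.Iio m).ncard := by simp [Set.ncard_eq_toFinset_card']
    _ = (factorAt u n '' Set.Iio m).ncard := hinj.ncard_image.symm
    _ ≤ _ := Set.ncard_le_ncard (by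
      rintro _ ⟨i, -, rfl⟩
      exact ⟨factorAt_mem_language _ _ _, by simp⟩) (finite_language_length u n)

end General

/-! ### Left special factors, complexity and the coding of desubstitution -/

section Binary

variable {u : ℕ → Fin 2}

/-- If every factor extends to the left, then the left special factors count the growth of the
factor complexity. -/
theorem complexity_succ (hu : ∀ w ∈ language u, ∃ a, a :: w ∈ language u) (n : ℕ) :
    complexity u (n + 1) = complexity u n + {w | IsLeftSpecial u w ∧ w.length = n}.ncard := by
  let X : Fin 2 → Set (List (Fin 2)) := fun a => {w | a :: w ∈ language u ∧ w.length = n}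
  have hX : ∀ a, (X a).Finite := fun a => (List.finite_length_eq _ n).subset fun _ h => h.2
  have h1 : {w ∈ language u | w.length = n + 1} =
      List.cons 0 '' X 0 ∪ List.cons 1 '' X 1 := by
    ext w
    constructor
    · rintro ⟨hw, hl⟩
      obtain ⟨a, w, rfl⟩ := List.exists_cons_of_length_eq_add_one hl
      have hl' : w.length = n := by simpa using hl
      fin_cases a
      · exact Or.inl ⟨w, ⟨hw, hl'⟩, rfl⟩
      · exact Or.inr ⟨w, ⟨hw, hl'⟩, rfl⟩
    · rintro (⟨w, ⟨hw, hl⟩, rfl⟩ | ⟨w, ⟨hw, hl⟩, rfl⟩)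
      · exact ⟨hw, by simp [hl]⟩
      · exact ⟨hw, by simp [hl]⟩
  have h2 : {w ∈ language u | w.length = n} = X 0 ∪ X 1 := by
    ext w
    constructor
    · rintro ⟨hw, hl⟩
      obtain ⟨a, ha⟩ := hu w hw
      fin_cases a
      · exact Or.inl ⟨ha, hl⟩
      · exact Or.inr ⟨ha, hl⟩
    · have key : ∀ a, w ∈ X a → w ∈ {w ∈ language u | w.length = n} := by
        rintro a ⟨ha, hl⟩
        obtain ⟨i, hi⟩ := exists_eq_factorAt ha
        rw [List.length_cons, factorAt_succ'] at hi
        injection hi with _ h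
        exact ⟨⟨i + 1, h.symm⟩, hl⟩
      rintro (h | h)
      exacts [key 0 h, key 1 h]
  have h3 : {w | IsLeftSpecial u w ∧ w.length = n} = X 0 ∩ X 1 := by
    ext w
    constructor
    · rintro ⟨⟨a, b, hab, ha, hb⟩, hl⟩
      fin_cases a <;> fin_cases b
      · exact absurd rfl hab
      · exact ⟨⟨ha, hl⟩, hb, hl⟩
      · exact ⟨⟨hb, hl⟩, ha, hl⟩
      · exact absurd rfl hab
    · rintro ⟨⟨h0, hl⟩, h1, -⟩
      exact ⟨⟨0, 1, by decide, h0, h1⟩, hl⟩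
  have hdisj : Disjoint (List.cons 0 '' X 0) (List.cons 1 '' X 1) := by
    rw [Set.disjoint_left]
    rintro _ ⟨w, -, rfl⟩ ⟨v, -, h⟩
    injection h with h _
    exact absurd h (by decide)
  rw [complexity, complexity, h1, h2, h3, Set.ncard_union_eq hdisj ((hX 0).image _) ((hX 1).image _),
    Set.ncard_image_of_injective _ List.cons_injective,
    Set.ncard_image_of_injective _ List.cons_injective,
    Set.ncard_union_add_ncard_inter _ _ (hX 0) (hX 1)]

theorem exists_cons_mem_language (hu : ∀ n, IsLeftSpecial u (factorAt u n 0)) :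
    ∀ w ∈ language u, ∃ a, a :: w ∈ language u := by
  intro w hw
  obtain ⟨i, hi⟩ := exists_eq_factorAt hw
  rcases i with _ | i
  · obtain ⟨a, -, -, ha, -⟩ := hu w.length
    exact ⟨a, hi ▸ ha⟩
  · refine ⟨u i, ?_⟩
    rw [hi, ← factorAt_succ']
    exact factorAt_mem_language _ _ _

/-- In a standard Sturmian word, the prefixes are the only left special factors. -/
theorem IsStandardSturmian.eq_prefix (hu : IsStandardSturmian u) {w : List (Fin 2)}
    (hw : IsLeftSpecial u w) : w = factorAt u w.length 0 := by
  have h := complexity_succ (exists_cons_mem_language hu.2) w.length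
  rw [hu.1, hu.1] at h
  have h1 : {v | IsLeftSpecial u v ∧ v.length = w.length}.ncard = 1 := by omega
  obtain ⟨x, hx⟩ := Set.ncard_eq_one.1 h1
  have h2 : w ∈ {v | IsLeftSpecial u v ∧ v.length = w.length} := ⟨hw, rfl⟩
  have h3 : factorAt u w.length 0 ∈ {v | IsLeftSpecial u v ∧ v.length = w.length} :=
    ⟨hu.2 _, by simp⟩
  rw [hx, Set.mem_singleton_iff] at h2 h3
  rw [h3]
  exact h2

/-- Two occurrences preceded by distinct letters make the factor left special, hence a prefix. -/
theorem IsStandardSturmian.agree_zero (hu : IsStandardSturmian u) {s t n : ℕ}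
    (h : Agree u (s + 1) (t + 1) n) (hne : u s ≠ u t) : Agree u (s + 1) 0 n := by
  have := hu.eq_prefix (isLeftSpecial_factorAt_iff.2 ⟨s, t, hne, fun _ _ => rfl, h.symm⟩)
  rw [length_factorAt] at this
  exact factorAt_eq_iff.1 this

/-- A word whose left special factors are exactly its prefixes is standard Sturmian. -/
theorem isStandardSturmian_of_agree (hu : ∀ n, IsLeftSpecial u (factorAt u n 0))
    (h : ∀ s t n, Agree u (s + 1) (t + 1) n → u s ≠ u t → Agree u (s + 1) 0 n) :
    IsStandardSturmian u := by
  refine ⟨fun n => ?_, hu⟩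
  induction n with
  | zero =>
    have : {w ∈ language u | w.length = 0} = {[]} := by
      ext w
      simp only [Set.mem_ofPred_eq, List.length_eq_zero_iff, Set.mem_singleton_iff,
        and_iff_right_iff_imp]
      rintro rfl
      exact ⟨0, by simp [factorAt]⟩
    rw [complexity, this, Set.ncard_singleton]
  | succ n ih =>
    have : {w | IsLeftSpecial u w ∧ w.length = n} = {factorAt u n 0} := by
      ext w
      simp only [Set.mem_ofPred_eq, Set.mem_singleton_iff]
      constructor
      · rintro ⟨hw, rfl⟩
        obtain ⟨i, hi⟩ := exists_eq_factorAt hw.mem_language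
        rw [hi] at hw
        obtain ⟨s, t, hne, hs, ht⟩ := isLeftSpecial_factorAt_iff.1 hw
        have := hs.symm.trans (h s t _ (hs.trans ht.symm) hne)
        exact hi.trans (factorAt_eq_iff.2 this)
      · rintro rfl
        exact ⟨hu n, by simp⟩
    rw [complexity_succ (exists_cons_mem_language hu), ih, this, Set.ncard_singleton]

theorem IsStandardSturmian.exists_ne (hu : IsStandardSturmian u) : ∃ s t, u s ≠ u t := by
  obtain ⟨s, t, h, -⟩ := isLeftSpecial_factorAt_iff.1 (hu.2 0)
  exact ⟨s, t, h⟩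

/-- The initial non-repetitive complexity is maximal at `n` if the prefix of length `n` does not
return too early. -/
theorem IsStandardSturmian.inrC_eq (hu : IsStandardSturmian u) {n : ℕ}
    (h : ∀ j, 0 < j → j ≤ n → ¬ Agree u 0 j n) : inrC u n = n + 1 := by
  have key : ∀ i d, 0 < d → i + d ≤ n → ¬ Agree u i (i + d) n := by
    intro i
    induction i with
    | zero => intro d hd hn; simpa using h d hd (by omega)
    | succ i ih =>
      intro d hd hn hag
      rw [add_right_comm] at hag
      -- Equal preceding letters move the repetition one step left; distinct ones make the prefix
      -- recur at `i + 1 ≤ n`.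
      by_cases hne : u i = u (i + d)
      · exact ih d hd (by omega) ((hag.cons hne).mono (by omega))
      · exact h (i + 1) (by omega) (by omega) (hu.agree_zero hag hne).symm
  refine IsGreatest.unique (isGreatest_inrC u n) ⟨fun i j hij hj heq => ?_, fun m hm => ?_⟩
  · refine key i (j - i) (by omega) (by omega) ?_
    rw [Nat.add_sub_cancel' hij.le]
    exact factorAt_eq_iff.1 heq
  · rw [← hu.1 n]
    exact InitialNonrepetitive.le_complexity hm

/-- The lengths of the bispecial factors. -/
def bispecialLengths (u : ℕ → Fin 2) : Set ℕ := {l | ∃ v, IsBispecial u v ∧ v.length = l}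

/-- The only left special word of length `m` is the prefix, so only its right speciality is in
question. -/
theorem IsStandardSturmian.mem_bispecialLengths_iff (hu : IsStandardSturmian u) {m : ℕ} :
    m ∈ bispecialLengths u ↔ ∃ s t, u (s + m) ≠ u (t + m) ∧ Agree u s 0 m ∧ Agree u t 0 m := by
  rw [← isRightSpecial_factorAt_iff]
  constructor
  · rintro ⟨v, ⟨h1, h2⟩, rfl⟩
    rwa [← hu.eq_prefix h1]
  · exact fun h => ⟨_, ⟨hu.2 m, h⟩, by simp⟩

/-- `v = φ_i(u)`, where `P t` is the position in `v` of the image of the letter `u t`. -/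
structure IsDesubstitution (i : Fin 2) (u v : ℕ → Fin 2) (P : ℕ → ℕ) : Prop where
  zero : P 0 = 0
  apply_pos (t : ℕ) : v (P t) = i
  apply_pos_succ (t : ℕ) : v (P t + 1) = u t
  pos_succ (t : ℕ) : P (t + 1) = P t + if u t = i then 1 else 2

theorem IsMorphicImage.exists_isDesubstitution {i : Fin 2} {u v : ℕ → Fin 2}
    (h : IsMorphicImage (elementary i) u v) : ∃ P, IsDesubstitution i u v P := by
  let P : ℕ → ℕ := fun n => ((factorAt u n 0).flatMap (elementary i)).length
  have hs : ∀ n, P (n + 1) = P n + (elementary i (u n)).length := by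
    intro n
    simp [P, factorAt_succ]
  have hP : ∀ t, P (t + 1) = P t + if u t = i then 1 else 2 := by
    intro t
    rw [hs, elementary]
    split_ifs <;> rfl
  have hf : ∀ t, factorAt v (elementary i (u t)).length (P t) = elementary i (u t) := by
    intro t
    have h1 := h (t + 1)
    have h0 := h t
    change factorAt v (P (t + 1)) 0 = _ at h1
    change factorAt v (P t) 0 = _ at h0
    rw [factorAt_succ, List.flatMap_append, ← h0, hs] at h1
    have h2 : factorAt v (P t + (elementary i (u t)).length) 0 =
        factorAt v (P t) 0 ++ factorAt v (elementary i (u t)).length (P t) := by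
      simp only [factorAt, List.range_add, List.map_append, List.map_map]
      congr 1
      refine List.map_congr_left fun k _ => ?_
      simp [Function.comp]
    rw [h2] at h1
    simpa using h1
  have ha : ∀ t, v (P t) = i := by
    intro t
    have := hf t
    by_cases hi : u t = i
    · simpa [elementary, hi, factorAt] using this
    · simp only [elementary, hi, if_false, List.length_cons, List.length_nil,
        factorAt_succ'] at this
      exact (List.cons.inj this).1
  refine ⟨P, rfl, ha, fun t => ?_, hP⟩
  -- The image of `i` has length 1, so the letter after `P t` is the first letter of the next block,
  -- again `i`.
  by_cases hi : u t = i
  · have := hP t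
    rw [if_pos hi] at this
    rw [← this, ha, hi]
  · have := hf t
    simp only [elementary, hi, if_false, List.length_cons, List.length_nil,
        factorAt_succ'] at this
    exact (List.cons.inj (List.cons.inj this).2).1

end Binary

/-! ### Transfer of special factors through an elementary morphism -/

namespace IsDesubstitution

variable {i : Fin 2} {u v : ℕ → Fin 2} {P : ℕ → ℕ}

theorem strictMono (h : IsDesubstitution i u v P) : StrictMono P := by
  refine strictMono_nat_of_lt_succ fun t => ?_
  rw [h.pos_succ]
  split_ifs <;> omega

theorem exists_pos (h : IsDesubstitution i u v P) (x : ℕ) :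
    ∃ t, P t = x ∨ (P t + 1 = x ∧ u t ≠ i) := by
  induction x with
  | zero => exact ⟨0, Or.inl h.zero⟩
  | succ x ih =>
    obtain ⟨t, rfl | ⟨rfl, ht⟩⟩ := ih
    · by_cases ht : u t = i
      · exact ⟨t + 1, Or.inl (by rw [h.pos_succ, if_pos ht])⟩
      · exact ⟨t, Or.inr ⟨rfl, ht⟩⟩
    · exact ⟨t + 1, Or.inl (by rw [h.pos_succ, if_neg ht])⟩

/-- The letter `i` occurs only at the start of a block, so its occurrences mark the block
decomposition. -/
theorem exists_pos_of_eq (h : IsDesubstitution i u v P) {x : ℕ} (hx : v x = i) :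
    ∃ t, P t = x := by
  obtain ⟨t, ht | ⟨rfl, ht⟩⟩ := h.exists_pos x
  · exact ⟨t, ht⟩
  · exact absurd (h.apply_pos_succ t ▸ hx) ht

theorem apply_succ_of_ne (h : IsDesubstitution i u v P) {x : ℕ} (hx : v x ≠ i) :
    v (x + 1) = i := by
  obtain ⟨t, rfl | ⟨rfl, ht⟩⟩ := h.exists_pos x
  · exact absurd (h.apply_pos t) hx
  · have := h.apply_pos (t + 1)
    rwa [h.pos_succ, if_neg ht] at this

/-- Each block ends with the letter it encodes, so left extensions in `v` at block boundaries are
those in `u`. -/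
theorem apply_pred_pos (h : IsDesubstitution i u v P) {t x : ℕ} (hx : P (t + 1) = x + 1) :
    v x = u t := by
  have hs := h.pos_succ t
  split_ifs at hs with ht
  · rw [show x = P t by omega, h.apply_pos, ht]
  · rw [show x = P t + 1 by omega, h.apply_pos_succ]

theorem apply_zero (h : IsDesubstitution i u v P) : v 0 = i := h.zero ▸ h.apply_pos 0

theorem apply_one (h : IsDesubstitution i u v P) : v 1 = u 0 := by
  have := h.apply_pos_succ 0
  rwa [h.zero] at this

/-- Equal factors of `u` have equal images, which are followed by the same letter `i`. -/
theorem agree_image (h : IsDesubstitution i u v P) {s t k d : ℕ} (hd : P (s + k) = P s + d)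
    (ha : Agree u s t k) : P (t + k) = P t + d ∧ Agree v (P s) (P t) (d + 1) := by
  induction k generalizing d with
  | zero =>
    obtain rfl : d = 0 := by simpa using hd
    refine ⟨rfl, fun x hx => ?_⟩
    obtain rfl : x = 0 := by omega
    simp [h.apply_pos]
  | succ k ih =>
    have hk : P (s + k) = P s + (P (s + k) - P s) := by
      have := h.strictMono.monotone (Nat.le_add_right s k)
      omega
    generalize P (s + k) - P s = e at hk
    obtain ⟨h1, h2⟩ := ih hk (ha.mono k.le_succ)
    have hl := ha k k.lt_succ_self
    have e1 := h.pos_succ (s + k)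
    have e2 := h.pos_succ (t + k)
    rw [← hl] at e2
    have h3 : Agree v (P s) (P t) (e + 1 + 1) := h2.succ <| by
      rw [← add_assoc, ← add_assoc, ← hk, ← h1, h.apply_pos_succ, h.apply_pos_succ, hl]
    rw [← add_assoc] at hd ⊢
    by_cases hi : u (s + k) = i
    · rw [if_pos hi] at e1 e2
      obtain rfl : d = e + 1 := by omega
      exact ⟨by omega, h3⟩
    · rw [if_neg hi] at e1 e2
      obtain rfl : d = e + 2 := by omega
      have h4 : P (t + k + 1) = P t + (e + 2) := by omega
      refine ⟨h4, h3.succ ?_⟩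
      rw [show P s + (e + 1 + 1) = P (s + k + 1) by omega,
        show P t + (e + 1 + 1) = P (t + k + 1) by omega, h.apply_pos, h.apply_pos]

/-- Each letter is decoded from the position just after its block start; the extra length 1 also
synchronizes the end of the last block. -/
theorem agree_of_image (h : IsDesubstitution i u v P) {s t k d : ℕ} (hd : P (s + k) = P s + d)
    (ha : Agree v (P s) (P t) (d + 1)) : Agree u s t k := by
  induction k generalizing d with
  | zero => exact fun x hx => absurd hx x.not_lt_zero
  | succ k ih =>
    have hk : P (s + k) = P s + (P (s + k) - P s) := by
      have := h.strictMono.monotone (Nat.le_add_right s k)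
      omega
    generalize P (s + k) - P s = e at hk
    have hlt : e < d := by
      have := h.strictMono (Nat.lt_succ_self (s + k))
      rw [Nat.succ_eq_add_one, add_assoc] at this
      omega
    have h1 := ih hk (ha.mono (by omega))
    refine h1.succ ?_
    have h2 := ha (e + 1) (by omega)
    rwa [← add_assoc, ← add_assoc, ← hk, ← (h.agree_image hk h1).1, h.apply_pos_succ,
      h.apply_pos_succ] at h2

theorem pos_zero_add (h : IsDesubstitution i u v P) (m : ℕ) : P (0 + m) = P 0 + P m := by
  simp [h.zero]

/-- Right extensions of `φ_i(w)i` in `v` are the right extensions of `w` in `u`, by decoding the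
letter after the final `i`. -/
theorem mem_bispecialLengths_iff (h : IsDesubstitution i u v P) (hu : IsStandardSturmian u)
    (hv : IsStandardSturmian v) {m : ℕ} :
    m ∈ bispecialLengths v ↔ m = 0 ∨ ∃ k ∈ bispecialLengths u, P k + 1 = m := by
  constructor
  · intro hm
    rcases m with _ | m
    · exact Or.inl rfl
    obtain ⟨s, t, hne, hs, ht⟩ := hv.mem_bispecialLengths_iff.1 hm
    -- A word ending in a letter other than `i` can only be followed by `i`, so it is not right
    -- special.
    have hvm : v m = i := by
      by_contra hi
      have key : ∀ x, Agree v x 0 (m + 1) → v (x + (m + 1)) = i := by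
        intro x hx
        rw [← add_assoc]
        refine h.apply_succ_of_ne ?_
        rwa [hx m m.lt_succ_self, zero_add]
      exact hne ((key s hs).trans (key t ht).symm)
    obtain ⟨k, rfl⟩ := h.exists_pos_of_eq hvm
    have key : ∀ x, Agree v x 0 (P k + 1) →
        ∃ y, Agree u y 0 k ∧ v (x + (P k + 1)) = u (y + k) := by
      intro x hx
      have hxi : v x = i := by
        have := hx 0 (by omega)
        rwa [add_zero, add_zero, h.apply_zero] at this
      obtain ⟨y, rfl⟩ := h.exists_pos_of_eq hxi
      have h1 : Agree u 0 y k := h.agree_of_image (h.pos_zero_add k) (by rw [h.zero]; exact hx.symm)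
      refine ⟨y, h1.symm, ?_⟩
      rw [← add_assoc, ← (h.agree_image (h.pos_zero_add k) h1).1, h.apply_pos_succ]
    obtain ⟨s', hs', es⟩ := key s hs
    obtain ⟨t', ht', et⟩ := key t ht
    refine Or.inr ⟨k, hu.mem_bispecialLengths_iff.2 ⟨s', t', ?_, hs', ht'⟩, rfl⟩
    rwa [← es, ← et]
  · rintro (rfl | ⟨k, hk, rfl⟩)
    · obtain ⟨s, t, hst⟩ := hv.exists_ne
      exact hv.mem_bispecialLengths_iff.2
        ⟨s, t, hst, fun x hx => absurd hx x.not_lt_zero, fun x hx => absurd hx x.not_lt_zero⟩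
    · obtain ⟨s, t, hne, hs, ht⟩ := hu.mem_bispecialLengths_iff.1 hk
      obtain ⟨h1, h2⟩ := h.agree_image (h.pos_zero_add k) hs.symm
      obtain ⟨h3, h4⟩ := h.agree_image (h.pos_zero_add k) ht.symm
      rw [h.zero] at h2 h4
      refine hv.mem_bispecialLengths_iff.2 ⟨P s, P t, ?_, h2.symm, h4.symm⟩
      rwa [← add_assoc, ← add_assoc, ← h1, ← h3, h.apply_pos_succ, h.apply_pos_succ]

theorem isMorphicImage (h : IsDesubstitution i u v P) : IsMorphicImage (elementary i) u v := by
  have key : ∀ n, factorAt v (P n) 0 = (factorAt u n 0).flatMap (elementary i) := by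
    intro n
    induction n with
    | zero => simp [h.zero, factorAt]
    | succ n ih =>
      rw [factorAt_succ, List.flatMap_append, ← ih, h.pos_succ]
      split_ifs with hi
      · simp [factorAt_succ, elementary, h.apply_pos, hi]
      · rw [show P n + 2 = P n + 1 + 1 from rfl, factorAt_succ, factorAt_succ]
        simp [elementary, h.apply_pos, h.apply_pos_succ, hi]
  intro n
  rw [← key n, length_factorAt]

/-- The desubstitution of a standard Sturmian word is standard Sturmian. -/
theorem isStandardSturmian (h : IsDesubstitution i u v P) (hv : IsStandardSturmian v) :
    IsStandardSturmian u := by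
  refine isStandardSturmian_of_agree (fun n => ?_) fun s t n ha hne => ?_
  · obtain ⟨s, t, hne, hs, ht⟩ := isLeftSpecial_factorAt_iff.1 (hv.2 (P n + 1))
    have key : ∀ x, Agree v (x + 1) 0 (P n + 1) → ∃ y, v x = u y ∧ Agree u (y + 1) 0 n := by
      intro x hx
      have hxi : v (x + 1) = i := by
        have := hx 0 (by omega)
        rwa [add_zero, add_zero, h.apply_zero] at this
      obtain ⟨y, hy⟩ := h.exists_pos_of_eq hxi
      rcases y with _ | y
      · rw [h.zero] at hy
        omega
      refine ⟨y, h.apply_pred_pos hy, ?_⟩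
      refine (h.agree_of_image (h.pos_zero_add n) ?_).symm
      rw [h.zero, hy]
      exact hx.symm
    obtain ⟨s', es, hs'⟩ := key s hs
    obtain ⟨t', et, ht'⟩ := key t ht
    refine isLeftSpecial_factorAt_iff.2 ⟨s', t', ?_, hs', ht'⟩
    rwa [← es, ← et]
  · have hpos : ∀ x, ∃ y, P (x + 1) = y + 1 := fun x =>
      Nat.exists_eq_succ_of_ne_zero (Nat.ne_zero_of_lt (h.strictMono x.lt_succ_self))
    obtain ⟨x, hx⟩ := hpos s
    obtain ⟨y, hy⟩ := hpos t
    obtain ⟨d, hd⟩ := Nat.exists_eq_add_of_le (h.strictMono.monotone (Nat.le_add_right (s + 1) n))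
    refine h.agree_of_image hd ?_
    have h1 := (h.agree_image hd ha).2
    rw [hx, hy] at h1
    rw [hx, h.zero]
    exact hv.agree_zero h1 (by rwa [h.apply_pred_pos hx, h.apply_pred_pos hy])

end IsDesubstitution

/-! ### Existence of directive sequences -/

/-- In a standard Sturmian word, the letter other than the first one is isolated. -/
theorem IsStandardSturmian.apply_succ_of_ne {u : ℕ → Fin 2} (hu : IsStandardSturmian u) {x : ℕ}
    (hx : u x ≠ u 0) : u (x + 1) = u 0 := by
  by_contra hx'
  -- At its first occurrence the other letter is preceded by `u 0`; if it also followed itself, it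
  -- would be left special, hence equal to `u 0`.
  have hex : ∃ y, u y ≠ u 0 := ⟨x, hx⟩
  obtain ⟨y, hy⟩ := Nat.exists_eq_succ_of_ne_zero
    (fun h0 : Nat.find hex = 0 => Nat.find_spec hex (by rw [h0]))
  have h1 : u (y + 1) ≠ u 0 := by
    have := Nat.find_spec hex
    rwa [hy] at this
  have h2 : u y = u 0 := by
    by_contra h
    have := Nat.find_min' hex h
    omega
  have h3 : Agree u (y + 1) (x + 1) 1 := by
    intro k hk
    obtain rfl : k = 0 := by omega
    have : ∀ a b c : Fin 2, a ≠ c → b ≠ c → a = b := by decide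
    exact this _ _ _ h1 hx'
  exact h1 (hu.agree_zero h3 (by rw [h2]; exact hx.symm) 0 one_pos)

theorem IsStandardSturmian.exists_isDesubstitution {v : ℕ → Fin 2} (hv : IsStandardSturmian v) :
    ∃ i u P, IsStandardSturmian u ∧ IsDesubstitution i u v P := by
  -- The morphism is forced by the first letter of `v`; a block has length 1 exactly when the next
  -- letter is `v 0` again.
  let P : ℕ → ℕ := fun t => Nat.rec 0 (fun _ p => p + if v (p + 1) = v 0 then 1 else 2) t
  have hP : ∀ t, P (t + 1) = P t + if v (P t + 1) = v 0 then 1 else 2 := fun _ => rfl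
  have h : IsDesubstitution (v 0) (fun t => v (P t + 1)) v P := by
    refine ⟨rfl, fun t => ?_, fun t => rfl, hP⟩
    induction t with
    | zero => rfl
    | succ t ih =>
      rw [hP]
      split_ifs with ht
      · exact ht
      · exact hv.apply_succ_of_ne ht
  exact ⟨_, _, P, h.isStandardSturmian hv, h⟩

theorem IsStandardSturmian.exists_isDirectiveSequence {u : ℕ → Fin 2}
    (hu : IsStandardSturmian u) : ∃ i, IsDirectiveSequence u i := by
  choose i next P hs hd using fun v : {v // IsStandardSturmian v} => v.2.exists_isDesubstitution
  let F : {v // IsStandardSturmian v} → {v // IsStandardSturmian v} := fun v => ⟨next v, hs v⟩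
  refine ⟨fun n => i (F^[n] ⟨u, hu⟩), fun n => (F^[n] ⟨u, hu⟩).1, rfl, fun n => ⟨Subtype.prop _, ?_⟩⟩
  have h := (hd (F^[n] ⟨u, hu⟩)).isMorphicImage
  rwa [show next (F^[n] ⟨u, hu⟩) = (F^[n + 1] ⟨u, hu⟩).1 by rw [Function.iterate_succ_apply']] at h

/-! ### Late returns and bispecial lengths along the directive sequence -/

/-- The prefix of length `m` of `u` is followed by two distinct letters, and the prefix of length
`m + 1` returns to none of the positions `1, …, m + 1`. -/
def HasLateReturn (u : ℕ → Fin 2) (m : ℕ) : Prop :=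
  u m ≠ u (m + 1) ∧ ∀ j, 0 < j → j ≤ m + 1 → ¬ Agree u 0 j (m + 1)

/-- A return of the image prefix decodes to a return in `u`, at some `t ≥ m + 2`. Exactly one of the
letters `u m`, `u (m + 1)` is `i`, so `P (m + 2) = P m + 3`, just beyond the forbidden range. -/
theorem HasLateReturn.image {i : Fin 2} {u v : ℕ → Fin 2} {P : ℕ → ℕ} {m : ℕ}
    (hm : HasLateReturn u m) (h : IsDesubstitution i u v P) : HasLateReturn v (P m + 1) := by
  obtain ⟨hne, hret⟩ := hm
  have e1 := h.pos_succ m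
  have e2 := h.pos_succ (m + 1)
  rw [add_assoc, one_add_one_eq_two] at e2
  constructor
  · rw [h.apply_pos_succ]
    by_cases hi : u m = i
    · rw [if_pos hi] at e1
      rwa [← e1, h.apply_pos_succ]
    · rw [if_neg hi] at e1
      rwa [add_assoc, one_add_one_eq_two, ← e1, h.apply_pos]
  · intro j hj hjm ha
    have hji : v j = i := by
      have := ha 0 (by omega)
      rwa [add_zero, add_zero, h.apply_zero, eq_comm] at this
    obtain ⟨t, rfl⟩ := h.exists_pos_of_eq hji
    have ha' : Agree v (P 0) (P t) (P m + 1 + 1) := by rwa [h.zero]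
    have h1 : Agree u 0 t m :=
      h.agree_of_image (h.pos_zero_add m) (ha'.mono (Nat.le_succ _))
    have h2 : Agree u 0 t (m + 1) := by
      refine h1.succ ?_
      rw [zero_add]
      have := ha (P m + 1) (by omega)
      rwa [← add_assoc, ← add_assoc, ← (h.agree_image (h.pos_zero_add m) h1).1,
        h.apply_pos_succ, zero_add, h.apply_pos_succ] at this
    have ht : 0 < t := by
      rcases t with _ | t
      · rw [h.zero] at hj
        omega
      · omega
    have ht' : m + 2 ≤ t := by
      by_contra hlt
      exact hret t ht (by omega) h2
    have hle := h.strictMono.monotone ht'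
    split_ifs at e1 e2 <;> omega

/-- The lengths of the bispecial factors of the `n`-th word of a sequence of words, each of which
is the image of the next one, where `P n` are the positions in the `n`-th word. -/
def bispecialLength (P : ℕ → ℕ → ℕ) : ℕ → ℕ → ℕ
  | 0, _ => 0
  | k + 1, n => P n (bispecialLength P k (n + 1)) + 1

section Directive

variable {i : ℕ → Fin 2} {U : ℕ → ℕ → Fin 2} {P : ℕ → ℕ → ℕ}

theorem strictMono_bispecialLength (hd : ∀ n, IsDesubstitution (i n) (U (n + 1)) (U n) (P n))
    (n : ℕ) : StrictMono fun k => bispecialLength P k n := by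
  refine strictMono_nat_of_lt_succ fun k => ?_
  induction k generalizing n with
  | zero => exact Nat.succ_pos _
  | succ k ih => exact Nat.succ_lt_succ ((hd n).strictMono (ih (n + 1)))

theorem range_bispecialLength (hU : ∀ n, IsStandardSturmian (U n))
    (hd : ∀ n, IsDesubstitution (i n) (U (n + 1)) (U n) (P n)) (n : ℕ) :
    Set.range (fun k => bispecialLength P k n) = bispecialLengths (U n) := by
  ext m
  constructor
  · rintro ⟨k, rfl⟩
    induction k generalizing n with
    | zero => exact ((hd n).mem_bispecialLengths_iff (hU _) (hU _)).2 (Or.inl rfl)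
    | succ k ih =>
      exact ((hd n).mem_bispecialLengths_iff (hU _) (hU _)).2 (Or.inr ⟨_, ih (n + 1), rfl⟩)
  · intro hm
    induction m using Nat.strong_induction_on generalizing n with
    | _ m ih =>
      rcases ((hd n).mem_bispecialLengths_iff (hU _) (hU _)).1 hm with rfl | ⟨l, hl, rfl⟩
      · exact ⟨0, rfl⟩
      -- The induction descends because `l ≤ P n l`.
      · obtain ⟨k, rfl⟩ := ih l (Nat.lt_succ_of_le (hd n).strictMono.le_apply) (n + 1) hl
        exact ⟨k + 1, rfl⟩

/-- A strictly increasing enumeration of the bispecial lengths must agree with `Nat.nth`. -/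
theorem length_B (hU : ∀ n, IsStandardSturmian (U n))
    (hd : ∀ n, IsDesubstitution (i n) (U (n + 1)) (U n) (P n)) (k : ℕ) :
    (B (U 0) k).length = bispecialLength P k 0 := by
  have hr := range_bispecialLength hU hd 0
  have hmono := strictMono_bispecialLength hd 0
  have hmem : ∀ k, ∃ v, IsBispecial (U 0) v ∧ v.length = bispecialLength P k 0 := fun k =>
    (hr ▸ Set.mem_range_self k : bispecialLength P k 0 ∈ bispecialLengths (U 0))
  have hnth : Nat.nth (fun l => ∃ v, IsBispecial (U 0) v ∧ v.length = l) k =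
      bispecialLength P k 0 := by
    have hinf : (Set.ofPred fun l => ∃ v, IsBispecial (U 0) v ∧ v.length = l).Infinite := by
      change (bispecialLengths (U 0)).Infinite
      rw [← hr]
      exact Set.infinite_range_of_injective hmono.injective
    rw [← Nat.nth_comp_of_strictMono hmono (fun m hm => by rw [hr]; exact hm)
      (fun hf => absurd hf hinf)]
    simp only [hmem, Nat.nth_true]
  have := Classical.epsilon_spec (hnth ▸ hmem k :
    ∃ v, IsBispecial (U 0) v ∧
      v.length = Nat.nth (fun l => ∃ v, IsBispecial (U 0) v ∧ v.length = l) k)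
  exact this.2.trans hnth

theorem hasLateReturn_bispecialLength
    (hd : ∀ n, IsDesubstitution (i n) (U (n + 1)) (U n) (P n)) (k n : ℕ)
    (hne : i (n + k) ≠ i (n + k + 1)) : HasLateReturn (U n) (bispecialLength P k n) := by
  induction k generalizing n with
  | zero =>
    have h01 : U n 0 ≠ U n 1 := by
      rwa [(hd n).apply_one, (hd n).apply_zero, (hd (n + 1)).apply_zero]
    refine ⟨h01, fun j hj hj' ha => h01 ?_⟩
    obtain rfl : j = 1 := by
      change j ≤ 0 + 1 at hj'
      omega
    exact ha 0 (Nat.succ_pos _)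
  | succ k ih =>
    refine (ih (n + 1) ?_).image (hd n)
    rwa [add_right_comm, add_assoc]

/-- With a constant tail, every word from level `K` on would be constant with identity block
positions, by induction on the position simultaneously at all those levels. -/
theorem exists_directive_ne (hU : ∀ n, IsStandardSturmian (U n))
    (hd : ∀ n, IsDesubstitution (i n) (U (n + 1)) (U n) (P n)) (K : ℕ) :
    ∃ k ≥ K, i k ≠ i (k + 1) := by
  by_contra! hcon
  have hi : ∀ n ≥ K, i n = i K := fun n hn => by
    induction n, hn using Nat.le_induction with
    | base => rfl
    | succ n hn ih => rw [← hcon n hn, ih]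
  have hc : ∀ x, ∀ n ≥ K, U n x = i K ∧ P n x = x := by
    intro x
    induction x with
    | zero => exact fun n hn => ⟨by rw [(hd n).apply_zero, hi n hn], (hd n).zero⟩
    | succ x ih =>
      intro n hn
      have h1 := (ih (n + 1) (by omega)).1
      have h2 := (ih n hn).2
      have h3 := (hd n).apply_pos_succ x
      have h4 := (hd n).pos_succ x
      rw [h1, hi n hn, if_pos rfl, h2] at h4
      rw [h2, h1] at h3
      exact ⟨h3, h4⟩
  obtain ⟨s, t, hst⟩ := (hU K).exists_ne
  exact hst ((hc s K le_rfl).1.trans (hc t K le_rfl).1.symm)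

theorem inrC_eq_of_directive_ne (hU : ∀ n, IsStandardSturmian (U n))
    (hd : ∀ n, IsDesubstitution (i n) (U (n + 1)) (U n) (P n)) {k : ℕ} (hne : i k ≠ i (k + 1)) :
    inrC (U 0) (bispecialLength P k 0 + 1) = bispecialLength P k 0 + 1 + 1 :=
  (hU 0).inrC_eq (hasLateReturn_bispecialLength hd k 0 (by rwa [zero_add])).2

end Directive

theorem IsDirectiveSequence.exists_isDesubstitution {u : ℕ → Fin 2} {i : ℕ → Fin 2}
    (h : IsDirectiveSequence u i) : ∃ (U : ℕ → ℕ → Fin 2) (P : ℕ → ℕ → ℕ), U 0 = u ∧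
      (∀ n, IsStandardSturmian (U n)) ∧ ∀ n, IsDesubstitution (i n) (U (n + 1)) (U n) (P n) := by
  obtain ⟨U, h0, hU⟩ := h
  choose P hP using fun n => (hU n).2.exists_isDesubstitution
  exact ⟨U, P, h0, fun n => (hU n).1, hP⟩

end InfWord

theorem corollary16 (u : ℕ → Fin 2) (hu : InfWord.IsStandardSturmian u) :
    {n : ℕ | InfWord.inrC u n = n + 1}.Infinite ∧
    (∃ i : ℕ → Fin 2, InfWord.IsDirectiveSequence u i) ∧
    ∀ i : ℕ → Fin 2, InfWord.IsDirectiveSequence u i →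
      ∀ k n : ℕ, i k ≠ i (k + 1) → n = (InfWord.B u k).length + 1 →
        InfWord.inrC u n = n + 1 := by
  refine ⟨?_, hu.exists_isDirectiveSequence, ?_⟩
  · obtain ⟨i, hi⟩ := hu.exists_isDirectiveSequence
    obtain ⟨U, P, rfl, hU, hd⟩ := hi.exists_isDesubstitution
    refine Set.infinite_of_forall_exists_gt fun a => ?_
    obtain ⟨k, hk, hne⟩ := InfWord.exists_directive_ne hU hd a
    -- Strict monotonicity gives `k ≤ bispecialLength P k 0`, so indices `k ≥ a` yield lengths
    -- beyond `a`.
    refine ⟨_, InfWord.inrC_eq_of_directive_ne hU hd hne, Nat.lt_succ_of_le (hk.trans ?_)⟩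
    exact (InfWord.strictMono_bispecialLength hd 0).le_apply
  · rintro i hi k n hne rfl
    obtain ⟨U, P, rfl, hU, hd⟩ := hi.exists_isDesubstitution
    rw [InfWord.length_B hU hd]
    exact InfWord.inrC_eq_of_directive_ne hU hd hne
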